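/- There are absolute constants $c, C > 0$ such that the following holds. Let $(X,d)$ be a finite metric space with at least two points and let $\lambda$ be its doubling constant, i.e. the minimal integer such that every ball of radius $2r$ in $X$ can be covered by $\lambda$ balls of radius $r$ centred in $X$. Let $d_{\max}$ and $d_{\min}$ be the largest and the smallest distance between two distinct points of $X$, let $\Phi = d_{\max}/d_{\min}$, $B = \lceil \log_2 \Phi\rceil$, and $\Delta_i = d_{\max}/2^i$ for $0 \le i \le B$. A $2$-hierarchical partition of $X$ is a sequence $H=(P_0,\dots,P_B)$ of partitions of $X$ such that every cluster of $P_i$ has diameter at most $\Delta_i$ for $0\le i\le B$, and $P_{i+1}$ is a refinement of $P_i$ for $0\le i<B$. For $x\in X$ let $P_i(x)$ be the cluster of $P_i$ that contains $x$. A finite set $\mathcal H$ of $2$-hierarchical partitions of $X$ is called an $\eta$-padded $2$-hierarchical partition family if for all $x\in X$ and all $0\le i\le B$ there is $H=(P_0,\dots,P_B)\in\mathcal H$ with $B(x,\eta\Delta_i)\subseteq P_i(x)$, where $B(x,r)=\{y\in X : d(x,y)\le r\}$. Then for every real $\alpha\ge 2$ there are $\eta$ with $c/\alpha\le\eta<1$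 and an $\eta$-padded $2$-hierarchical partition family of $X$ of size at most $C\,\lambda^{1/\alpha}\,\log\alpha\,\log\lambda$. -/

import Mathlib

universe u

noncomputable section

/-- Every ball of radius `2 * r` can be covered by at most `n` balls of radius `r`
(centred at points of `X`). -/
def HasDoublingBound (X : Type*) [MetricSpace X] (n : ℕ) : Prop :=
  ∀ (x : X) (r : ℝ), 0 < r → ∃ s : Finset X, s.card ≤ n ∧
    Metric.closedBall x (2 * r) ⊆ ⋃ c ∈ s, Metric.closedBall c r

/-- The doubling constant: the minimal `n` such that every ball of radius `2 * r` can be covered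
by `n` balls of radius `r`. (For a finite space the set below contains the number of points; open
and closed balls give the same value.) -/
def doublingConstant (X : Type*) [MetricSpace X] : ℕ :=
  sInf {n : ℕ | HasDoublingBound X n}

/-- The largest distance between two points of a finite metric space. -/
def dMax (X : Type*) [MetricSpace X] : ℝ := Metric.diam (Set.univ : Set X)

/-- The smallest distance between two distinct points of a finite metric space. -/
def dMin (X : Type*) [MetricSpace X] : ℝ := Set.infsep (Set.univ : Set X)

/-- The aspect ratio `Φ(X)`. -/
def aspectRatio (X : Type*) [MetricSpace X] : ℝ := dMax X / dMin X

/-- The cluster `P(x)` of the partition `P` that contains `x`. A partition is given by its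
equivalence relation; its clusters are the equivalence classes `P.classes`. -/
def cluster {X : Type*} (P : Setoid X) (x : X) : Set X := {y | P y x}

/-- `P` is a `Δ`-bounded partition: each of its clusters has diameter at most `Δ`. -/
def IsBoundedPartition {X : Type*} [MetricSpace X] (Δ : ℝ) (P : Setoid X) : Prop :=
  ∀ C ∈ P.classes, Metric.diam C ≤ Δ

/-- A `μ`-hierarchical partition of `X` for the range `[Δ, Δ / μ ^ B]`: partitions
`P_0, …, P_B` such that `P_i` is `Δ / μ ^ i`-bounded and `P_{i+1}` is a refinement of `P_i`. -/
@[ext]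
structure HierarchicalPartition (X : Type*) [MetricSpace X] (μ Δ : ℝ) (B : ℕ) where
  part : Fin (B + 1) → Setoid X
  bounded : ∀ i : Fin (B + 1), IsBoundedPartition (Δ / μ ^ (i : ℕ)) (part i)
  refines : ∀ i : Fin B, part i.succ ≤ part i.castSucc

/-- The last level of a full range hierarchy: `log_μ Φ(X)`, rounded up to an integer, so that
all the scales `0 ≤ i ≤ log_μ Φ(X)` occur and the last scale is at most `dMin X`. -/
def numLevels (X : Type*) [MetricSpace X] (μ : ℝ) : ℕ := ⌈Real.logb μ (aspectRatio X)⌉₊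

/-- A full range `μ`-hierarchical partition: the scales are `Δ_i = dMax X / μ ^ i`. -/
abbrev FullHierarchicalPartition (X : Type*) [MetricSpace X] (μ : ℝ) : Type _ :=
  HierarchicalPartition X μ (dMax X) (numLevels X μ)

/-- A finite set `𝓗` of full range `μ`-hierarchical partitions of `X` is an `η`-padded
`μ`-hierarchical partition family: for each point `x` and each scale `i` some member of `𝓗` has
`B(x, η Δ_i) ⊆ P_i(x)`. -/
def IsPaddedFamily {X : Type*} [MetricSpace X] {μ : ℝ} (η : ℝ)
    (𝓗 : Finset (FullHierarchicalPartition X μ)) : Prop :=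
  ∀ (x : X) (i : Fin (numLevels X μ + 1)), ∃ H ∈ 𝓗,
    Metric.closedBall x (η * (dMax X / μ ^ (i : ℕ))) ⊆ cluster (H.part i) x

end

/-!
Single scale. Take a net of mesh `R` and give each net point `v` an independent exponential
variable of rate `β`, truncated at `1`; in a fixed order, the net points carve out what is left of
their balls of radius `R * (1 + t v)`. Since the exponential distribution has no memory, a ball
`B(x, ρ)` stays in one cluster with probability about `exp (-β * ξ)`, `ξ = 2 * ρ / R`, as long as
`exp (β / 2)` exceeds the number of net points near `x`, which is at most `λ ^ 3`
(`le_measureReal_padEvent`).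

A block of scales. Let `η = 1 / (576 * α)`, and consider `k = O(log α)` consecutive scales with
independent carvings. With respect to the radius `η * Δ_s`, the padding parameters at the levels
`s, s - 1, …` form a geometric series, so that the intersection of all the partitions up to level
`s` is padded at `x` with probability `≳ λ ^ (-1 / α)`: passing to refinements within a block costs
only a constant factor. It is enough to pad the points of a net of mesh `η * Δ_k`, and the event
that `M` independent copies all fail at such a point and level shares variables with at most
`k * λ ^ (2 * k + 1)` others. By the Lovász local lemma
(`exists_forall_notMem_of_determinedBy`), some choice of `M = O(λ ^ (1 / α) * k * log λ)` copies
pads every point at every level of the block (`exists_block_partitions`); the factor `log α` of the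
bound is this `k`.

All scales. The scales are divided into blocks of length `2 * k`, of which only the upper half is
padded. Clusters of the top partition of a block have diameter at most `2 ^ (-k)`, hence at most
`η`, times any padded scale of the block before it, so that they may be merged as a whole into the
clusters of that block at the cost of a constant factor in the padding radius (`exists_hierarchy`).
This makes the partitions a hierarchy, while different blocks need no common choice of randomness.
Shifting the blocks by `k` pads the other half of the scales, so `2 * M` hierarchies suffice.
-/

/-! ### Doubling spaces: covering and packing -/

theorem hasDoublingBound_doublingConstant (X : Type*) [MetricSpace X] [Finite X] :
    HasDoublingBound X (doublingConstant X) := by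
  classical
  have := Fintype.ofFinite X
  refine Nat.sInf_mem (s := {n : ℕ | HasDoublingBound X n}) ⟨Fintype.card X, fun x r hr => ?_⟩
  refine ⟨Finset.univ, le_rfl, fun y _ => ?_⟩
  simp only [Finset.mem_univ, Set.iUnion_true, Set.mem_iUnion]
  exact ⟨y, Metric.mem_closedBall_self hr.le⟩

/-- Iterating the doubling condition `j` times. -/
theorem HasDoublingBound.exists_cover {X : Type*} [MetricSpace X] {n : ℕ}
    (h : HasDoublingBound X n) (j : ℕ) (x : X) {r : ℝ} (hr : 0 < r) :
    ∃ s : Finset X, s.card ≤ n ^ j ∧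
      Metric.closedBall x r ⊆ ⋃ c ∈ s, Metric.closedBall c (r / 2 ^ j) := by
  classical
  induction j with
  | zero => exact ⟨{x}, by simp, by simp⟩
  | succ j ih =>
    obtain ⟨s, hs, hcov⟩ := ih
    choose t ht htc using fun c : X => h c (r / 2 ^ (j + 1)) (by positivity)
    refine ⟨s.biUnion t, ?_, fun y hy => ?_⟩
    · calc _ ≤ s.card * n := Finset.card_biUnion_le_card_mul _ _ _ fun c _ => ht c
        _ ≤ n ^ (j + 1) := by rw [pow_succ]; gcongr
    · obtain ⟨c, hc, hyc⟩ := Set.mem_iUnion₂.1 (hcov hy)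
      have h2 : 2 * (r / 2 ^ (j + 1)) = r / 2 ^ j := by rw [pow_succ]; field_simp
      have := htc c (by rw [h2]; exact hyc)
      obtain ⟨e, he, hye⟩ := Set.mem_iUnion₂.1 this
      exact Set.mem_iUnion₂.2 ⟨e, Finset.mem_biUnion.2 ⟨c, hc, he⟩, hye⟩

/-- A packing bound: separated points in a ball are no more numerous than the small balls
covering it. -/
theorem HasDoublingBound.card_le {X : Type*} [MetricSpace X] {n : ℕ}
    (h : HasDoublingBound X n) (j : ℕ) (x : X) {r ε : ℝ} (hr : 0 < r) (hε : 2 * (r / 2 ^ j) ≤ ε)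
    (t : Finset X) (ht : ∀ y ∈ t, dist y x ≤ r)
    (hsep : ∀ y ∈ t, ∀ z ∈ t, y ≠ z → ε < dist y z) : t.card ≤ n ^ j := by
  classical
  obtain ⟨s, hs, hcov⟩ := h.exists_cover j x hr
  have hmem : ∀ y ∈ t, ∃ c ∈ s, dist y c ≤ r / 2 ^ j := fun y hy => by
    obtain ⟨c, hc, hyc⟩ := Set.mem_iUnion₂.1 (hcov (Metric.mem_closedBall.2 (ht y hy)))
    exact ⟨c, hc, hyc⟩
  choose! f hf hfd using hmem
  refine (Finset.card_le_card_of_injOn f (fun y hy => hf y hy) fun y hy z hz hyz => ?_).trans hs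
  by_contra hne
  have h1 := hsep y hy z hz hne
  have h2 := hfd y hy
  have h3 := hfd z hz
  rw [← hyz] at h3
  linarith [dist_triangle_right y z (f y)]

theorem two_le_doublingConstant (X : Type*) [MetricSpace X] [Finite X] [Nontrivial X] :
    2 ≤ doublingConstant X := by
  classical
  have := Fintype.ofFinite X
  -- Two points at the smallest positive distance cannot lie in one ball of half that radius.
  obtain ⟨a, b, hab⟩ := exists_pair_ne X
  obtain ⟨⟨x, y⟩, hxy, hmin⟩ := Finset.exists_min_image
    (Finset.univ.filter fun p : X × X => p.1 ≠ p.2) (fun p => dist p.1 p.2) ⟨(a, b), by simp [hab]⟩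
  simp only [Finset.mem_filter, Finset.mem_univ, true_and] at hxy hmin
  have hd : 0 < dist x y := dist_pos.2 hxy
  obtain ⟨s, hs, hcov⟩ := hasDoublingBound_doublingConstant X x (dist x y / 2) (by linarith)
  have key : ∀ z, dist z x ≤ dist x y → z ∈ s := fun z hz => by
    obtain ⟨c, hc, hzc⟩ := Set.mem_iUnion₂.1
      (hcov (Metric.mem_closedBall.2 (by linarith : dist z x ≤ 2 * (dist x y / 2))))
    rw [Metric.mem_closedBall] at hzc
    by_cases hzc' : z = c
    · rwa [hzc']
    · have := hmin (z, c) hzc'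
      simp only at this
      linarith
  calc 2 = ({x, y} : Finset X).card := by rw [Finset.card_pair hxy]
    _ ≤ s.card := Finset.card_le_card fun z hz => by
        rcases Finset.mem_insert.1 hz with rfl | hz
        · exact key _ (by simp)
        · rw [Finset.mem_singleton.1 hz]; exact key _ (by rw [dist_comm])
    _ ≤ _ := hs

/-- `N` is a net at scale `R`: its points are more than `R` apart, and every point of the space
is within `R` of `N`. -/
structure IsNet {X : Type*} [MetricSpace X] (R : ℝ) (N : Finset X) : Prop where
  separated : ∀ y ∈ N, ∀ z ∈ N, y ≠ z → R < dist y z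
  covers : ∀ x, ∃ y ∈ N, dist x y ≤ R

theorem exists_isNet (X : Type*) [MetricSpace X] [Finite X] {R : ℝ} (hR : 0 ≤ R) :
    ∃ N : Finset X, IsNet R N := by
  classical
  have := Fintype.ofFinite X
  obtain ⟨N, hN, hmax⟩ := Finset.exists_max_image
    (Finset.univ.filter fun N : Finset X => ∀ y ∈ N, ∀ z ∈ N, y ≠ z → R < dist y z)
    Finset.card ⟨∅, by simp⟩
  simp only [Finset.mem_filter, Finset.mem_univ, true_and] at hN hmax
  refine ⟨N, hN, fun x => ?_⟩
  by_contra! hx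
  have hxN : x ∉ N := fun h => by simpa using (hx x h).trans_le' hR
  have := hmax (insert x N) fun y hy z hz hyz => by
    rcases Finset.mem_insert.1 hy with rfl | hyN <;> rcases Finset.mem_insert.1 hz with rfl | hzN
    · exact absurd rfl hyz
    · exact hx z hzN
    · rw [dist_comm]; exact hx y hyN
    · exact hN y hyN z hzN hyz
  rw [Finset.card_insert_of_notMem hxN] at this
  omega

open MeasureTheory ProbabilityTheory

/-! ### Independence in finite products and the local lemma -/

section Independence

variable {I T : Type*}

/-- The event `A` is determined by the coordinates in `S`. -/
def DeterminedBy (A : Set (I → T)) (S : Set I) : Prop :=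
  ∀ ω ω' : I → T, (∀ i ∈ S, ω i = ω' i) → (ω ∈ A ↔ ω' ∈ A)

theorem DeterminedBy.mono {A : Set (I → T)} {S S' : Set I} (h : DeterminedBy A S) (hS : S ⊆ S') :
    DeterminedBy A S' := fun ω ω' h' => h ω ω' fun i hi => h' i (hS hi)

theorem DeterminedBy.compl {A : Set (I → T)} {S : Set I} (h : DeterminedBy A S) :
    DeterminedBy Aᶜ S := fun ω ω' h' => not_congr (h ω ω' h')

theorem DeterminedBy.biInter {J : Type*} {A : J → Set (I → T)} {s : Finset J} {S : Set I}
    (h : ∀ j ∈ s, DeterminedBy (A j) S) : DeterminedBy (⋂ j ∈ s, A j) S := fun ω ω' h' => by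
  simp only [Set.mem_iInter]
  exact forall₂_congr fun j hj => h j hj ω ω' h'

theorem DeterminedBy.iInter {J : Type*} {A : J → Set (I → T)} {S : Set I}
    (h : ∀ j, DeterminedBy (A j) S) : DeterminedBy (⋂ j, A j) S := fun ω ω' h' => by
  simp only [Set.mem_iInter]
  exact forall_congr' fun j => h j ω ω' h'

theorem DeterminedBy.biUnion {J : Type*} {A : J → Set (I → T)} {s : Finset J} {S : Set I}
    (h : ∀ j ∈ s, DeterminedBy (A j) S) : DeterminedBy (⋃ j ∈ s, A j) S := fun ω ω' h' => by
  simp only [Set.mem_iUnion]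
  exact exists_congr fun j => exists_congr fun hj => h j hj ω ω' h'

theorem DeterminedBy.inter {A B : Set (I → T)} {S : Set I} (hA : DeterminedBy A S)
    (hB : DeterminedBy B S) : DeterminedBy (A ∩ B) S := fun ω ω' h' =>
  and_congr (hA ω ω' h') (hB ω ω' h')

theorem determinedBy_eval (i : I) (U : Set T) : DeterminedBy {ω : I → T | ω i ∈ U} {i} :=
  fun ω ω' h => by simp [h i rfl]

variable [Fintype I] [MeasurableSpace T] (ν : Measure T) [IsProbabilityMeasure ν]

/-- Events determined by disjoint sets of coordinates are independent. -/
theorem measureReal_inter_of_determinedBy {A B : Set (I → T)} {S S' : Set I}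
    (hA : MeasurableSet A) (hB : MeasurableSet B) (hAS : DeterminedBy A S)
    (hBS : DeterminedBy B S') (hS : Disjoint S S') :
    (Measure.pi fun _ : I => ν).real (A ∩ B) =
      (Measure.pi fun _ : I => ν).real A * (Measure.pi fun _ : I => ν).real B := by
  classical
  obtain ⟨t⟩ : Nonempty T := nonempty_of_isProbabilityMeasure ν
  -- `A` is the preimage of a measurable set under the restriction to `S`.
  have pre : ∀ (C : Set (I → T)) (U : Set I), MeasurableSet C → DeterminedBy C U →
      ∃ C' : Set (U.toFinset → T), MeasurableSet C' ∧ C = (fun ω (i : U.toFinset) => ω i) ⁻¹' C' := by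
    intro C U hC hCU
    refine ⟨(fun z i => if h : i ∈ U.toFinset then z ⟨i, h⟩ else t) ⁻¹' C, ?_, ?_⟩
    · refine (measurable_pi_lambda _ fun i => ?_) hC
      by_cases h : i ∈ U.toFinset
      · simpa only [h, dif_pos] using measurable_pi_apply _
      · simpa only [h, dif_neg, not_false_eq_true] using measurable_const
    · ext ω
      refine hCU _ _ fun i hi => ?_
      simp [hi]
  obtain ⟨A', hA', rfl⟩ := pre A S hA hAS
  obtain ⟨B', hB', rfl⟩ := pre B S' hB hBS
  have hind := (iIndepFun_pi (μ := fun _ : I => ν) (X := fun _ => id)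
    fun i => measurable_id.aemeasurable).indepFun_finset S.toFinset S'.toFinset
      (by simpa using hS) fun i => measurable_pi_apply i
  have := hind.measure_inter_preimage_eq_mul A' B' hA' hB'
  simp only [id] at this
  rw [measureReal_def, this, ENNReal.toReal_mul]
  rfl

/-- Finitely many events determined by pairwise disjoint sets of coordinates are independent. -/
theorem measureReal_biInter_of_determinedBy {J : Type*} (s : Finset J) {A : J → Set (I → T)}
    {S : J → Set I} (hA : ∀ j ∈ s, MeasurableSet (A j)) (hAS : ∀ j ∈ s, DeterminedBy (A j) (S j))
    (hS : ∀ j ∈ s, ∀ j' ∈ s, j ≠ j' → Disjoint (S j) (S j')) :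
    (Measure.pi fun _ : I => ν).real (⋂ j ∈ s, A j) =
      ∏ j ∈ s, (Measure.pi fun _ : I => ν).real (A j) := by
  classical
  induction s using Finset.induction_on with
  | empty => simp
  | insert a s ha ih =>
    rw [Finset.prod_insert ha, Finset.set_biInter_insert,
      ← ih (fun j hj => hA j (Finset.mem_insert_of_mem hj))
        (fun j hj => hAS j (Finset.mem_insert_of_mem hj))
        (fun j hj j' hj' => hS j (Finset.mem_insert_of_mem hj) j' (Finset.mem_insert_of_mem hj'))]
    refine measureReal_inter_of_determinedBy (S := S a) (S' := ⋃ j ∈ s, S j) ν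
      (hA a (Finset.mem_insert_self a s))
      (Finset.measurableSet_biInter _ fun j hj => hA j (Finset.mem_insert_of_mem hj))
      (hAS a (Finset.mem_insert_self a s)) (DeterminedBy.biInter fun j hj =>
        (hAS j (Finset.mem_insert_of_mem hj)).mono (Set.subset_biUnion_of_mem (u := S) hj)) ?_
    refine Set.disjoint_iUnion₂_right.2 fun j hj => hS a (Finset.mem_insert_self a s) j
      (Finset.mem_insert_of_mem hj) ?_
    rintro rfl
    exact ha hj

theorem measureReal_eval (i : I) {U : Set T} (hU : MeasurableSet U) :
    (Measure.pi fun _ : I => ν).real {ω | ω i ∈ U} = ν.real U := by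
  have := (measurePreserving_eval (fun _ : I => ν) i).measure_preimage hU.nullMeasurableSet
  rw [measureReal_def, measureReal_def, ← this]
  rfl

/-- The symmetric Lovász local lemma: if each event has probability at most `p` and shares
coordinates with at most `d` events (itself included), and `4 * p * d ≤ 1`, then all the events
can be avoided at once. -/
theorem exists_forall_notMem_of_determinedBy {J : Type*} [Fintype J] {A : J → Set (I → T)}
    {S : J → Set I} (hA : ∀ j, MeasurableSet (A j)) (hAS : ∀ j, DeterminedBy (A j) (S j))
    {p d : ℝ} (hp : ∀ j, (Measure.pi fun _ : I => ν).real (A j) ≤ p)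
    (hd : ∀ (j : J) (t : Finset J), (∀ j' ∈ t, ¬ Disjoint (S j) (S j')) → (t.card : ℝ) ≤ d)
    (hd1 : 1 ≤ d) (hpd : 4 * p * d ≤ 1) : ∃ ω, ∀ j, ω ∉ A j := by
  classical
  set μ := Measure.pi fun _ : I => ν with hμ
  have hms : ∀ s : Finset J, MeasurableSet (⋂ j ∈ s, (A j)ᶜ) := fun s =>
    Finset.measurableSet_biInter _ fun j _ => (hA j).compl
  rcases isEmpty_or_nonempty J with hJ | ⟨⟨j₀⟩⟩
  · obtain ⟨t⟩ : Nonempty T := nonempty_of_isProbabilityMeasure ν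
    exact ⟨fun _ => t, fun j => isEmptyElim j⟩
  have hp0 : 0 ≤ p := measureReal_nonneg.trans (hp j₀)
  -- Conditionally on avoiding the events in `s`, the event `j` has probability at most `2 * p`.
  have key : ∀ (n : ℕ) (s : Finset J), s.card = n → ∀ j, j ∉ s →
      μ.real (A j ∩ ⋂ i ∈ s, (A i)ᶜ) ≤ 2 * p * μ.real (⋂ i ∈ s, (A i)ᶜ) := by
    intro n
    induction n using Nat.strong_induction_on with
    | _ n ih =>
    intro s hs j hj
    set s₁ := s.filter fun i => ¬ Disjoint (S j) (S i) with hs₁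
    set s₂ := s.filter fun i => Disjoint (S j) (S i) with hs₂
    have hs12 : ∀ i, i ∈ s ↔ i ∈ s₁ ∨ i ∈ s₂ := fun i => by
      simp only [hs₁, hs₂, Finset.mem_filter]; tauto
    have hind : μ.real (A j ∩ ⋂ i ∈ s₂, (A i)ᶜ) = μ.real (A j) * μ.real (⋂ i ∈ s₂, (A i)ᶜ) := by
      refine measureReal_inter_of_determinedBy (S := S j) (S' := ⋃ i ∈ s₂, S i) ν (hA j) (hms s₂)
        (hAS j) (DeterminedBy.biInter fun i hi =>
          ((hAS i).compl).mono (Set.subset_biUnion_of_mem (u := S) hi)) ?_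
      exact Set.disjoint_iUnion₂_right.2 fun i hi => (Finset.mem_filter.1 hi).2
    have h1 : μ.real (A j ∩ ⋂ i ∈ s, (A i)ᶜ) ≤ p * μ.real (⋂ i ∈ s₂, (A i)ᶜ) := by
      calc _ ≤ μ.real (A j ∩ ⋂ i ∈ s₂, (A i)ᶜ) := measureReal_mono
            (Set.inter_subset_inter_right _
              (Set.biInter_subset_biInter_left fun i hi => (Finset.mem_filter.1 hi).1))
        _ ≤ _ := by rw [hind]; gcongr; exact hp j
    -- The events of `s₁` remove at most half of the mass that avoids those of `s₂`.
    have h2 : μ.real (⋂ i ∈ s₂, (A i)ᶜ) ≤ 2 * μ.real (⋂ i ∈ s, (A i)ᶜ) := by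
      by_cases hemp : s₁ = ∅
      · have : s₂ = s := by
          ext i; rw [hs12, hemp]; simp
        rw [this]
        linarith [measureReal_nonneg (μ := μ) (s := ⋂ i ∈ s, (A i)ᶜ)]
      have hcard : s₂.card < n := by
        rw [← hs]
        refine Finset.card_lt_card ((Finset.filter_subset _ _).ssubset_of_ne fun h => hemp ?_)
        refine Finset.filter_eq_empty_iff.2 fun i hi => not_not.2 ?_
        rw [← h] at hi
        exact (Finset.mem_filter.1 hi).2
      have hsub : (⋂ i ∈ s₂, (A i)ᶜ) ⊆
          (⋂ i ∈ s, (A i)ᶜ) ∪ ⋃ i ∈ s₁, (A i ∩ ⋂ i ∈ s₂, (A i)ᶜ) := by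
        intro ω hω
        by_cases h : ∃ i ∈ s₁, ω ∈ A i
        · obtain ⟨i, hi, hωi⟩ := h
          exact Or.inr (Set.mem_iUnion₂.2 ⟨i, hi, hωi, hω⟩)
        · push Not at h
          refine Or.inl (Set.mem_iInter₂.2 fun i hi => ?_)
          rcases (hs12 i).1 hi with hi | hi
          · exact h i hi
          · exact Set.mem_iInter₂.1 hω i hi
      have h3 : μ.real (⋃ i ∈ s₁, (A i ∩ ⋂ i ∈ s₂, (A i)ᶜ)) ≤
          d * (2 * p * μ.real (⋂ i ∈ s₂, (A i)ᶜ)) := by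
        calc _ ≤ ∑ i ∈ s₁, μ.real (A i ∩ ⋂ i ∈ s₂, (A i)ᶜ) := measureReal_biUnion_finset_le _ _
          _ ≤ ∑ i ∈ s₁, 2 * p * μ.real (⋂ i ∈ s₂, (A i)ᶜ) :=
            Finset.sum_le_sum fun i hi => ih _ hcard s₂ rfl i fun hi2 =>
              (Finset.mem_filter.1 hi).2 (Finset.mem_filter.1 hi2).2
          _ = s₁.card * (2 * p * μ.real (⋂ i ∈ s₂, (A i)ᶜ)) := by simp
          _ ≤ _ := by
            gcongr
            exact hd j s₁ fun i hi => (Finset.mem_filter.1 hi).2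
      have h4 := (measureReal_mono hsub).trans (measureReal_union_le (μ := μ) _ _)
      have h5 : d * (2 * p * μ.real (⋂ i ∈ s₂, (A i)ᶜ)) ≤ 1 / 2 * μ.real (⋂ i ∈ s₂, (A i)ᶜ) := by
        rw [← mul_assoc]
        gcongr
        linarith
      linarith
    nlinarith
  -- Hence adding the events one at a time never exhausts the probability space.
  have hpos : ∀ s : Finset J, 0 < μ.real (⋂ i ∈ s, (A i)ᶜ) := by
    intro s
    induction s using Finset.induction_on with
    | empty => simp
    | insert j s hj ih =>
      have h1 := key _ s rfl j hj
      have h2 := measureReal_inter_add_sdiff (μ := μ) (s := ⋂ i ∈ s, (A i)ᶜ) (hA j)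
      rw [Set.inter_comm] at h1
      have h3 : (⋂ i ∈ insert j s, (A i)ᶜ) = (⋂ i ∈ s, (A i)ᶜ) \ A j := by
        rw [Finset.set_biInter_insert, Set.inter_comm, Set.sdiff_eq]
      rw [h3]
      have h4 : 2 * p ≤ 1 / 2 := by nlinarith
      nlinarith
  obtain ⟨ω, hω⟩ : (⋂ i ∈ (Finset.univ : Finset J), (A i)ᶜ).Nonempty := by
    rw [Set.nonempty_iff_ne_empty]
    intro h
    have := hpos Finset.univ
    rw [h] at this
    simp at this
  exact ⟨ω, fun j => Set.mem_iInter₂.1 hω j (Finset.mem_univ j)⟩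

end Independence

/-! ### Random ball carving at a single scale -/

theorem mem_cluster {X : Type*} {P : Setoid X} {x y : X} : y ∈ cluster P x ↔ P y x := Iff.rfl

/-- Truncation of a real number to `[0, 1]`. -/
noncomputable def clamp (t : ℝ) : ℝ := max 0 (min t 1)

theorem measurable_clamp : Measurable clamp := by
  unfold clamp; fun_prop

theorem clamp_nonneg (t : ℝ) : 0 ≤ clamp t := le_max_left _ _

theorem clamp_le_one (t : ℝ) : clamp t ≤ 1 := max_le zero_le_one (min_le_right _ _)

theorem le_clamp_iff {τ t : ℝ} (h0 : 0 < τ) (h1 : τ ≤ 1) : τ ≤ clamp t ↔ τ ≤ t := by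
  simp [clamp, h1, h0.not_ge]

/-- The tail of a truncated exponential variable. -/
theorem expMeasure_le_clamp {β : ℝ} (hβ : 0 < β) (τ : ℝ) :
    (expMeasure β).real {t | τ ≤ clamp t} =
      if τ ≤ 0 then 1 else if τ ≤ 1 then Real.exp (-(β * τ)) else 0 := by
  have := isProbabilityMeasure_expMeasure hβ
  split_ifs with h0 h1
  · have : {t | τ ≤ clamp t} = Set.univ :=
      Set.eq_univ_of_forall fun t => h0.trans (clamp_nonneg t)
    simp [this]
  · push Not at h0
    have h : {t | τ ≤ clamp t} = Set.Ici τ := by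
      ext t; exact le_clamp_iff h0 h1
    have hna : (expMeasure β) {τ} = 0 := by
      rw [expMeasure, gammaMeasure]
      exact withDensity_absolutelyContinuous _ _ (by simp)
    have hIoi : (expMeasure β).real (Set.Ici τ) = (expMeasure β).real (Set.Ioi τ) := by
      rw [← Set.Ioi_union_left]
      refine le_antisymm ((measureReal_union_le _ _).trans ?_)
        (measureReal_mono Set.subset_union_left)
      simp [measureReal_def, hna]
    rw [h, hIoi, ← Set.compl_Iic, probReal_compl_eq_one_sub measurableSet_Iic, ← cdf_eq_real,
      cdf_expMeasure_eq hβ, if_pos h0.le]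
    ring
  · have : {t | τ ≤ clamp t} = ∅ :=
      Set.eq_empty_of_forall_notMem fun t ht => h1 (le_trans ht (clamp_le_one t))
    simp [this]

section Carving

variable {X : Type*} [MetricSpace X] [LinearOrder X]

/-- The first point `v` of `N`, in the order of `X`, whose ball of radius `R * (1 + clamp (t v))`
contains `x` (and `x` itself if there is none). -/
noncomputable def carveCenter (N : Finset X) (R : ℝ) (t : X → ℝ) (x : X) : X :=
  if h : (N.filter fun v => dist x v ≤ R * (1 + clamp (t v))).Nonempty then
    (N.filter fun v => dist x v ≤ R * (1 + clamp (t v))).min' h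
  else x

/-- Ball carving: the points of `N` in turn take all the points not yet taken in their ball of
radius `R * (1 + clamp (t v))`. -/
noncomputable def carve (N : Finset X) (R : ℝ) (t : X → ℝ) : Setoid X :=
  Setoid.ker (carveCenter N R t)

theorem dist_carveCenter_le {N : Finset X} {R : ℝ} (hR : 0 ≤ R) (t : X → ℝ) (x : X) :
    dist x (carveCenter N R t x) ≤ 2 * R := by
  unfold carveCenter
  split_ifs with h
  · have := (Finset.mem_filter.1 (Finset.min'_mem _ h)).2
    refine this.trans ?_
    have := clamp_le_one (t (Finset.min' _ h))
    nlinarith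
  · simpa using hR

theorem dist_le_of_carve {N : Finset X} {R : ℝ} (hR : 0 ≤ R) (t : X → ℝ) {x y : X}
    (h : carve N R t x y) : dist x y ≤ 4 * R := by
  have h1 := dist_carveCenter_le (N := N) hR t x
  have h2 := dist_carveCenter_le (N := N) hR t y
  have h3 : carveCenter N R t x = carveCenter N R t y := h
  rw [← h3] at h2
  linarith [dist_triangle_right x y (carveCenter N R t x)]

/-- The value that `clamp (t v)` has to reach for the ball around `v` to have a chance to meet
the ball of radius `ρ` around `x`. -/
noncomputable def reach (R ρ : ℝ) (x v : X) : ℝ := (dist x v - ρ) / R - 1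

/-- If the ball of `v` swallows the ball of radius `ρ` around `x` and no earlier ball meets it,
then that ball is contained in one cluster. Points of `N` at distance more than `2 * R + ρ` from
`x` never matter. -/
theorem closedBall_subset_carve {N : Finset X} {R ρ : ℝ} (hR : 0 < R) (hρ : 0 ≤ ρ) {t : X → ℝ}
    {x v : X} (hv : v ∈ N) (hvt : reach R ρ x v + 2 * ρ / R ≤ clamp (t v))
    (hu : ∀ u ∈ N, dist x u ≤ 2 * R + ρ → u < v → clamp (t u) < reach R ρ x u) :
    Metric.closedBall x ρ ⊆ cluster (carve N R t) x := by
  have key : ∀ z, dist z x ≤ ρ → carveCenter N R t z = v := by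
    intro z hz
    have hzv : dist z v ≤ R * (1 + clamp (t v)) := by
      have h1 : R * (1 + (reach R ρ x v + 2 * ρ / R)) = dist x v + ρ := by
        unfold reach; field_simp; ring
      calc dist z v ≤ dist x v + ρ := by linarith [dist_triangle z x v]
        _ ≤ _ := by rw [← h1]; gcongr
    have hmem : v ∈ N.filter fun v => dist z v ≤ R * (1 + clamp (t v)) :=
      Finset.mem_filter.2 ⟨hv, hzv⟩
    unfold carveCenter
    rw [dif_pos ⟨v, hmem⟩]
    refine le_antisymm (Finset.min'_le _ _ hmem) (Finset.le_min' _ _ _ fun u hu' => ?_)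
    by_contra! huv
    obtain ⟨huN, hzu⟩ := Finset.mem_filter.1 hu'
    have hxu : dist x u ≤ dist z u + ρ := by
      rw [dist_comm z x] at hz; linarith [dist_triangle x z u]
    have h1 := clamp_le_one (t u)
    have h2 := hu u huN (by nlinarith) huv
    unfold reach at h2
    rw [lt_sub_iff_add_lt, lt_div_iff₀ hR] at h2
    linarith
  intro z hz
  change carveCenter N R t z = carveCenter N R t x
  rw [key z hz, key x (by simpa using hρ)]

variable {I : Type*}

/-- The event that the ball of radius `ρ` around `x` is swallowed by some ball before any other
ball meets it. The variable `t v` is the coordinate `e v` of the sample point. -/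
def padEvent (N : Finset X) (R ρ : ℝ) (x : X) (e : X → I) : Set (I → ℝ) :=
  ⋃ v ∈ N.filter fun v => dist x v ≤ 2 * R + ρ,
    ({ω | ω (e v) ∈ {t | reach R ρ x v + 2 * ρ / R ≤ clamp t}} ∩
      ⋂ u ∈ (N.filter fun v => dist x v ≤ 2 * R + ρ).filter (· < v),
        {ω | ω (e u) ∈ {t | reach R ρ x u ≤ clamp t}}ᶜ)

theorem closedBall_subset_of_mem_padEvent {N : Finset X} {R ρ : ℝ} (hR : 0 < R) (hρ : 0 ≤ ρ)
    {x : X} {e : X → I} {ω : I → ℝ} (hω : ω ∈ padEvent N R ρ x e) :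
    Metric.closedBall x ρ ⊆ cluster (carve N R fun v => ω (e v)) x := by
  obtain ⟨v, hv, hvt, hu⟩ := Set.mem_iUnion₂.1 hω
  refine closedBall_subset_carve hR hρ (Finset.mem_filter.1 hv).1 hvt fun u huN hxu huv => ?_
  have := Set.mem_iInter₂.1 hu u
    (Finset.mem_filter.2 ⟨Finset.mem_filter.2 ⟨huN, hxu⟩, huv⟩)
  simpa using this

theorem determinedBy_padEvent (N : Finset X) (R ρ : ℝ) (x : X) (e : X → I) :
    DeterminedBy (padEvent N R ρ x e) (e '' {v | dist x v ≤ 2 * R + ρ}) := by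
  refine DeterminedBy.biUnion fun v hv => DeterminedBy.inter ?_ (DeterminedBy.biInter fun u hu => ?_)
  · refine (determinedBy_eval _ _).mono ?_
    rintro _ rfl
    exact ⟨v, (Finset.mem_filter.1 hv).2, rfl⟩
  · refine (determinedBy_eval _ _).compl.mono ?_
    rintro _ rfl
    exact ⟨u, (Finset.mem_filter.1 (Finset.mem_filter.1 hu).1).2, rfl⟩

theorem measurableSet_le_clamp (τ : ℝ) : MeasurableSet {t | τ ≤ clamp t} :=
  measurableSet_le measurable_const measurable_clamp

theorem measurableSet_padEvent [Fintype I] (N : Finset X) (R ρ : ℝ) (x : X) (e : X → I) :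
    MeasurableSet (padEvent N R ρ x e) := by
  have h : ∀ (i : I) (τ : ℝ), MeasurableSet {ω : I → ℝ | ω i ∈ {t | τ ≤ clamp t}} := fun i τ =>
    measurable_pi_apply i (measurableSet_le_clamp τ)
  exact Finset.measurableSet_biUnion _ fun v _ => (h _ _).inter
    (Finset.measurableSet_biInter _ fun u _ => (h _ _).compl)

/-- The padding probability. The exponential distribution has no memory, so whenever a ball
reaches the `ρ`-ball around `x`, it swallows it with probability at least `exp (-β * ξ)`, where
`ξ = 2 * ρ / R`; this fails only for balls that reach it in the last `ξ`-fraction of their range,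
which has probability at most `exp (-β / 2)` for each of the `K` relevant ones. -/
theorem le_measureReal_padEvent [Fintype I] {N : Finset X} {R ρ β K : ℝ} (hN : IsNet R N)
    (hR : 0 < R) (hρ : 0 ≤ ρ) (hξ : 2 * ρ / R ≤ 1 / 2) (hβ : 0 < β) (x : X) {e : X → I}
    (he : Function.Injective e)
    (hK : ((N.filter fun v => dist x v ≤ 2 * R + ρ).card : ℝ) ≤ K) :
    Real.exp (-(β * (2 * ρ / R))) * (1 - K * Real.exp (-(β / 2))) ≤
      (Measure.pi fun _ : I => expMeasure β).real (padEvent N R ρ x e) := by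
  classical
  have hprob := isProbabilityMeasure_expMeasure hβ
  set N' := N.filter fun v => dist x v ≤ 2 * R + ρ with hN'
  set ξ := 2 * ρ / R with hξdef
  have hξ0 : 0 ≤ ξ := by positivity
  set τ := reach R ρ x with hτ
  set a : X → ℝ := fun v => (expMeasure β).real {t | τ v ≤ clamp t} with ha
  set c : X → ℝ := fun v => (expMeasure β).real {t | τ v + ξ ≤ clamp t} with hc
  have ha1 : ∀ v, 0 ≤ 1 - a v := fun v => sub_nonneg.2 measureReal_le_one
  have ha0 : ∀ v, 0 ≤ a v := fun v => measureReal_nonneg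
  set E : X → Set (I → ℝ) := fun v => {ω | ω (e v) ∈ {t | τ v + ξ ≤ clamp t}} ∩
      ⋂ u ∈ N'.filter (· < v), {ω | ω (e u) ∈ {t | τ u ≤ clamp t}}ᶜ with hE
  have hm : ∀ (i : I) (τ : ℝ), MeasurableSet {ω : I → ℝ | ω i ∈ {t | τ ≤ clamp t}} := fun i τ =>
    measurable_pi_apply i (measurableSet_le_clamp τ)
  have hEmeas : ∀ v, MeasurableSet (E v) := fun v => (hm _ _).inter
    (Finset.measurableSet_biInter _ fun u _ => (hm _ _).compl)
  have hEprob : ∀ v, (Measure.pi fun _ : I => expMeasure β).real (E v) =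
      c v * ∏ u ∈ N'.filter (· < v), (1 - a u) := by
    intro v
    rw [hE]
    simp only
    rw [measureReal_inter_of_determinedBy (S := {e v}) (S' := e '' {u | u < v}) _ (hm _ _)
      (Finset.measurableSet_biInter _ fun u _ => (hm _ _).compl) (determinedBy_eval _ _)
      (DeterminedBy.biInter fun u hu => (determinedBy_eval _ _).compl.mono ?_) ?_,
      measureReal_eval _ _ (measurableSet_le_clamp _),
      measureReal_biInter_of_determinedBy (S := fun u => {e u}) _ _ (fun u _ => (hm _ _).compl)
        (fun u _ => (determinedBy_eval _ _).compl) ?_]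
    · congr 1
      refine Finset.prod_congr rfl fun u _ => ?_
      rw [probReal_compl_eq_one_sub (hm _ _), measureReal_eval _ _ (measurableSet_le_clamp _)]
    · intro u _ u' _ huu'
      simpa using fun h => huu' (he h)
    · rw [Set.disjoint_singleton_left]
      rintro ⟨u, hu, hue⟩
      rw [he hue] at hu
      exact lt_irrefl _ hu
    · rintro _ rfl
      exact ⟨u, (Finset.mem_filter.1 hu).2, rfl⟩
  have hdisj : ∀ v ∈ N', ∀ w ∈ N', v < w → Disjoint (E v) (E w) := by
    intro v hv w _ hvw
    refine Set.disjoint_left.2 fun ω h1 h2 => ?_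
    refine Set.mem_iInter₂.1 h2.2 v (Finset.mem_filter.2 ⟨hv, hvw⟩) ?_
    have : τ v + ξ ≤ clamp (ω (e v)) := h1.1
    change τ v ≤ clamp (ω (e v))
    linarith
  have hsum : (Measure.pi fun _ : I => expMeasure β).real (padEvent N R ρ x e) =
      ∑ v ∈ N', c v * ∏ u ∈ N'.filter (· < v), (1 - a u) := by
    rw [← Finset.sum_congr rfl fun v _ => hEprob v]
    refine measureReal_biUnion_finset (fun v hv w hw hvw => ?_) fun v _ => hEmeas v
    rcases lt_or_gt_of_ne hvw with h | h
    · exact hdisj v hv w hw h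
    · exact (hdisj w hw v hv h).symm
  have hcomp : ∀ v, Real.exp (-(β * ξ)) * (a v - Real.exp (-(β / 2))) ≤ c v := by
    intro v
    have hθ : 0 < Real.exp (-(β * ξ)) := Real.exp_pos _
    have hβξ : 0 ≤ β * ξ := by positivity
    have hδ : 0 < Real.exp (-(β / 2)) := Real.exp_pos _
    by_cases h : τ v + ξ ≤ 1
    · have : Real.exp (-(β * ξ)) * a v ≤ c v := by
        simp only [ha, hc, expMeasure_le_clamp hβ]
        by_cases h0 : τ v ≤ 0
        · rw [if_pos h0, if_pos h, mul_one]
          split_ifs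
          · exact Real.exp_le_one_iff.2 (by linarith)
          · exact Real.exp_le_exp.2 (by nlinarith)
        · rw [if_neg h0, if_pos h, if_pos (by linarith), if_neg (by linarith), ← Real.exp_add]
          exact Real.exp_le_exp.2 (by linarith)
      nlinarith
    · have : a v ≤ Real.exp (-(β / 2)) := by
        simp only [ha, expMeasure_le_clamp hβ]
        rw [if_neg (by linarith)]
        split_ifs
        · exact Real.exp_le_exp.2 (by nlinarith)
        · exact hδ.le
      have : 0 ≤ c v := measureReal_nonneg
      nlinarith
  -- Some point of the net is certain to reach `x`.
  have hzero : ∏ v ∈ N', (1 - a v) = 0 := by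
    obtain ⟨v, hv, hxv⟩ := hN.covers x
    refine Finset.prod_eq_zero (Finset.mem_filter.2 ⟨hv, by linarith⟩ : v ∈ N') ?_
    have : τ v ≤ 0 := by
      simp only [hτ, reach]
      rw [sub_nonpos, div_le_one hR]
      linarith
    simp [ha, expMeasure_le_clamp hβ, this]
  rw [Finset.prod_one_sub_ordered] at hzero
  rw [hsum]
  calc Real.exp (-(β * ξ)) * (1 - K * Real.exp (-(β / 2)))
      ≤ Real.exp (-(β * ξ)) * (∑ v ∈ N', a v * ∏ u ∈ N'.filter (· < v), (1 - a u)
        - ∑ v ∈ N', Real.exp (-(β / 2)) * ∏ u ∈ N'.filter (· < v), (1 - a u)) := by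
        have h1 : ∑ v ∈ N', Real.exp (-(β / 2)) * ∏ u ∈ N'.filter (· < v), (1 - a u) ≤
            K * Real.exp (-(β / 2)) := by
          calc _ ≤ ∑ v ∈ N', Real.exp (-(β / 2)) := Finset.sum_le_sum fun v _ =>
                mul_le_of_le_one_right (Real.exp_pos _).le
                  (Finset.prod_le_one (fun u _ => ha1 u) fun u _ => by linarith [ha0 u])
            _ = N'.card * Real.exp (-(β / 2)) := by simp
            _ ≤ _ := by gcongr
        gcongr
        linarith
    _ = ∑ v ∈ N', Real.exp (-(β * ξ)) * (a v - Real.exp (-(β / 2))) *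
          ∏ u ∈ N'.filter (· < v), (1 - a u) := by
        rw [← Finset.sum_sub_distrib, Finset.mul_sum]
        exact Finset.sum_congr rfl fun v _ => by ring
    _ ≤ _ := Finset.sum_le_sum fun v _ =>
        mul_le_mul_of_nonneg_right (hcomp v) (Finset.prod_nonneg fun u _ => ha1 u)

end Carving

/-! ### Padded partitions for a block of consecutive scales -/

/-- The padding parameters over the levels `ℓ ≤ s` of a block form a geometric series. -/
theorem sum_two_pow_div_le (k : ℕ) (s : Fin k) :
    ∑ ℓ ∈ Finset.univ.filter (fun ℓ : Fin k => ℓ ≤ s), (2 : ℝ) ^ (ℓ : ℕ) / 2 ^ (s : ℕ) ≤ 2 := by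
  have h : ∑ ℓ ∈ Finset.univ.filter (fun ℓ : Fin k => ℓ ≤ s), (2 : ℝ) ^ (ℓ : ℕ) ≤
      ∑ i ∈ Finset.range (s + 1), (2 : ℝ) ^ i := by
    rw [Finset.sum_filter]
    simp only [Fin.le_def]
    rw [Fin.sum_univ_eq_sum_range (fun i => if i ≤ (s : ℕ) then (2 : ℝ) ^ i else 0) k,
      ← Finset.sum_filter]
    refine Finset.sum_le_sum_of_subset_of_nonneg (fun i hi => ?_) fun i _ _ => by positivity
    exact Finset.mem_range.2 (Nat.lt_succ_of_le (Finset.mem_filter.1 hi).2)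
  rw [← Finset.sum_div, div_le_iff₀ (by positivity)]
  refine h.trans ?_
  rw [geom_sum_eq (by norm_num), pow_succ]
  norm_num
  linarith

/-- The block lemma. For the scales `D / 2 ^ ℓ`, `ℓ < k`, there are `M` sequences of bounded
partitions such that for each point and each `s < k` one of the sequences has all its partitions
`ℓ ≤ s` padded with respect to the smallest scale `D / 2 ^ s`. Since the padding radius is fixed
while the scale doubles, the exponents of the losses in probability at the levels `s, s - 1, …`
decrease geometrically and add up to at most `2 * β / a`. The rate `β` is chosen so that truncation
costs each of the `k` levels only a factor `1 - 1 / (2 * k)`, hence all of them at most `1 / 2`.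
The local lemma applies because a point only depends on the net points at distance `D / 2`. -/
theorem exists_block_partitions {X : Type*} [MetricSpace X] [Finite X] {n k M : ℕ} (hn : 1 ≤ n)
    (hX : HasDoublingBound X n) {a D β : ℝ} (hD : 0 < D) (ha : 24 ≤ a) (hk : 1 ≤ k)
    (hak : 48 * a ≤ 2 ^ k) (hβ : β = 2 * Real.log (2 * k * n ^ 3))
    (hM : 4 * (1 - 1 / 2 * Real.exp (-(2 * β / a))) ^ M * (k * n ^ (2 * k + 1)) ≤ 1) :
    ∃ Q : Fin M → ℕ → Setoid X, (∀ m ℓ x y, Q m ℓ x y → dist x y ≤ D / 2 ^ ℓ / 2) ∧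
      ∀ x, ∀ s < k, ∃ m, ∀ ℓ ≤ s,
        Metric.closedBall x (2 * (1 / (48 * a)) * (D / 2 ^ s)) ⊆ cluster (Q m ℓ) x := by
  classical
  have := Fintype.ofFinite X
  let _ : LinearOrder X := LinearOrder.lift' (Fintype.equivFin X) (Fintype.equivFin X).injective
  have ha0 : 0 < a := by linarith
  have hk' : (1 : ℝ) ≤ k := by exact_mod_cast hk
  have hn' : (1 : ℝ) ≤ n := by exact_mod_cast hn
  have hn3 : (1 : ℝ) ≤ n ^ 3 := one_le_pow₀ hn'
  have hkn : 1 < 2 * k * (n : ℝ) ^ 3 := by nlinarith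
  have hβ0 : 0 < β := by rw [hβ]; have := Real.log_pos hkn; linarith
  have hprob := isProbabilityMeasure_expMeasure hβ0
  set η : ℝ := 1 / (48 * a) with hη
  have hη0 : 0 < η := by positivity
  have hηa : η * a = 1 / 48 := by rw [hη]; field_simp
  set R : ℕ → ℝ := fun ℓ => D / 2 ^ ℓ / 8 with hR
  set ρ : ℕ → ℝ := fun s => 3 * η * (D / 2 ^ s) with hρ
  have hR0 : ∀ ℓ, 0 < R ℓ := fun ℓ => by simp only [hR]; positivity
  have hρ0 : ∀ s, 0 < ρ s := fun s => by simp only [hρ]; positivity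
  have hRD : ∀ ℓ, R ℓ ≤ D / 8 := fun ℓ => by
    simp only [hR]
    gcongr
    exact div_le_self hD.le (one_le_pow₀ (by norm_num))
  have hξ : ∀ ℓ s, 2 * ρ s / R ℓ = 2 ^ ℓ / 2 ^ s / a := fun ℓ s => by
    simp only [hR, hρ, hη]; field_simp; norm_num
  have hξ1 : ∀ ℓ s, ℓ ≤ s → 2 * ρ s / R ℓ ≤ 1 / 2 := fun ℓ s h => by
    rw [hξ]
    have : (2 : ℝ) ^ ℓ / 2 ^ s ≤ 1 :=
      div_le_one_of_le₀ (pow_le_pow_right₀ (by norm_num) h) (by positivity)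
    rw [div_le_iff₀ ha0]
    linarith
  have hρR : ∀ ℓ s, ℓ ≤ s → ρ s ≤ R ℓ := fun ℓ s h => by
    have := hξ1 ℓ s h
    rw [div_le_iff₀ (hR0 ℓ)] at this
    linarith [hR0 ℓ]
  choose N hN using fun ℓ => exists_isNet X (hR0 ℓ).le
  obtain ⟨Y, hY⟩ := exists_isNet X (R := η * (D / 2 ^ k)) (by positivity)
  let I := Fin M × Fin k × X
  let e : Fin M → Fin k → X → I := fun m ℓ v => (m, ℓ, v)
  let P : Fin M → Fin k → Fin k → X → Set (I → ℝ) := fun m s ℓ y =>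
    padEvent (N ℓ) (R ℓ) (ρ s) y (e m ℓ)
  have hPm : ∀ m s ℓ y, MeasurableSet (P m s ℓ y) := fun m s ℓ y => measurableSet_padEvent _ _ _ _ _
  have hPd : ∀ m s ℓ y, DeterminedBy (P m s ℓ y) (e m ℓ '' {v | dist y v ≤ 2 * R ℓ + ρ s}) :=
    fun m s ℓ y => determinedBy_padEvent _ _ _ _ _
  let G : Fin M → Fin k → X → Set (I → ℝ) := fun m s y =>
    ⋂ ℓ ∈ Finset.univ.filter (fun ℓ : Fin k => ℓ ≤ s), P m s ℓ y
  have hGm : ∀ m s y, MeasurableSet (G m s y) := fun m s y =>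
    Finset.measurableSet_biInter _ fun ℓ _ => hPm m s ℓ y
  have hGd : ∀ m s y, DeterminedBy (G m s y) {i | i.1 = m ∧ dist y i.2.2 ≤ D / 2} := by
    refine fun m s y => DeterminedBy.biInter fun ℓ hℓ => (hPd m s ℓ y).mono ?_
    rintro _ ⟨v, hv, rfl⟩
    have h1 := hρR ℓ s (Finset.mem_filter.1 hℓ).2
    have h2 := hRD ℓ
    change dist y v ≤ 2 * R ℓ + ρ s at hv
    exact ⟨rfl, by linarith⟩
  have hGp : ∀ m s y, 1 / 2 * Real.exp (-(2 * β / a)) ≤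
      (Measure.pi fun _ : I => expMeasure β).real (G m s y) := by
    intro m s y
    rw [measureReal_biInter_of_determinedBy _ _ (fun ℓ _ => hPm m s ℓ y) (fun ℓ _ => hPd m s ℓ y)]
    swap
    · intro ℓ _ ℓ' _ hne
      refine Set.disjoint_left.2 ?_
      rintro _ ⟨v, _, rfl⟩ ⟨v', _, h⟩
      exact hne (congrArg (fun i : I => i.2.1) h).symm
    have hone : ∀ ℓ ∈ Finset.univ.filter (fun ℓ : Fin k => ℓ ≤ s),
        Real.exp (-(β * ((2 : ℝ) ^ (ℓ : ℕ) / 2 ^ (s : ℕ) / a))) * (1 - 1 / (2 * k)) ≤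
        (Measure.pi fun _ : I => expMeasure β).real (P m s ℓ y) := by
      intro ℓ hℓ
      have hℓs : (ℓ : ℕ) ≤ s := (Finset.mem_filter.1 hℓ).2
      have hcard : (((N ℓ).filter fun v => dist y v ≤ 2 * R ℓ + ρ s).card : ℝ) ≤ (n : ℝ) ^ 3 := by
        have := hX.card_le 3 y (r := 4 * R ℓ) (ε := R ℓ) (by linarith [hR0 ℓ]) (by linarith)
          ((N ℓ).filter fun v => dist y v ≤ 2 * R ℓ + ρ s) (fun v hv => by
            have h1 := (Finset.mem_filter.1 hv).2
            have h2 := hρR ℓ s hℓs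
            rw [dist_comm]
            linarith [hR0 ℓ]) (fun u hu v hv huv => (hN ℓ).separated u (Finset.mem_filter.1 hu).1 v
              (Finset.mem_filter.1 hv).1 huv)
        exact_mod_cast this
      have := le_measureReal_padEvent (hN ℓ) (hR0 ℓ) (hρ0 s).le (hξ1 ℓ s hℓs) hβ0 y (e := e m ℓ)
        (fun v v' h => congrArg (fun i : I => i.2.2) h) hcard
      rw [hξ] at this
      have h2 : (n : ℝ) ^ 3 * Real.exp (-(β / 2)) = 1 / (2 * k) := by
        rw [hβ, mul_div_cancel_left₀ _ (two_ne_zero), Real.exp_neg, Real.exp_log (by linarith)]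
        field_simp
      rwa [h2] at this
    have hk2 : 0 ≤ 1 - 1 / (2 * (k : ℝ)) := by
      rw [sub_nonneg, div_le_one (by linarith)]; linarith
    refine le_trans ?_ (Finset.prod_le_prod (fun ℓ _ => by positivity) hone)
    rw [Finset.prod_mul_distrib, mul_comm, ← Real.exp_sum, Finset.prod_const]
    gcongr ?_ * ?_
    · rw [Finset.sum_neg_distrib, ← Finset.mul_sum, ← Finset.sum_div, Real.exp_le_exp,
        neg_le_neg_iff]
      calc _ ≤ β * (2 / a) := by gcongr; exact sum_two_pow_div_le k s
        _ = _ := by ring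
    · calc (1 / 2 : ℝ) = 1 + k * (-(1 / (2 * k))) := by field_simp; norm_num
        _ ≤ (1 + -(1 / (2 * k))) ^ k := one_add_mul_le_pow (by linarith) k
        _ = (1 - 1 / (2 * (k : ℝ))) ^ k := by rw [← sub_eq_add_neg]
        _ ≤ _ := pow_le_pow_of_le_one hk2 (by
              have : 0 ≤ 1 / (2 * (k : ℝ)) := by positivity
              linarith) (by
              simpa using Finset.card_le_univ (Finset.univ.filter (fun ℓ : Fin k => ℓ ≤ s)))
  -- The bad events: no sequence is padded at the net point `y` and the levels up to `s`.
  let A : Y × Fin k → Set (I → ℝ) := fun j => ⋂ m : Fin M, (G m j.2 j.1)ᶜ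
  obtain ⟨ω, hω⟩ := exists_forall_notMem_of_determinedBy (expMeasure β) (A := A)
    (S := fun j => {i : I | dist (j.1 : X) i.2.2 ≤ D / 2})
    (p := (1 - 1 / 2 * Real.exp (-(2 * β / a))) ^ M) (d := k * n ^ (2 * k + 1))
    (fun j => MeasurableSet.iInter fun m => (hGm m _ _).compl)
    (fun j => DeterminedBy.iInter fun m => ((hGd m _ _).mono fun i hi => hi.2).compl)
    (fun j => by
      have h1 : A j = ⋂ m ∈ (Finset.univ : Finset (Fin M)), (G m j.2 j.1)ᶜ := by simp [A]
      rw [h1, measureReal_biInter_of_determinedBy _ _ (fun m _ => (hGm m _ _).compl)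
        (fun m _ => (hGd m _ _).compl)]
      · calc _ ≤ ∏ m : Fin M, (1 - 1 / 2 * Real.exp (-(2 * β / a))) :=
              Finset.prod_le_prod (fun m _ => measureReal_nonneg) fun m _ => by
                rw [probReal_compl_eq_one_sub (hGm _ _ _)]
                linarith [hGp m j.2 j.1]
          _ = _ := by simp
      · intro m _ m' _ hne
        refine Set.disjoint_left.2 fun i hi hi' => hne ?_
        rw [← hi.1, hi'.1])
    (fun j t ht => by
      have hdist : ∀ j' ∈ t, dist (j'.1 : X) j.1 ≤ D := fun j' hj' => by
        obtain ⟨i, hi, hi'⟩ := Set.not_disjoint_iff.1 (ht j' hj')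
        change dist (j.1 : X) i.2.2 ≤ D / 2 at hi
        change dist (j'.1 : X) i.2.2 ≤ D / 2 at hi'
        linarith [dist_triangle_right (j'.1 : X) j.1 i.2.2]
      have h1 : (t.image fun j' => (j'.1 : X)).card ≤ n ^ (2 * k + 1) := by
        refine hX.card_le (2 * k + 1) j.1 (r := D) (ε := η * (D / 2 ^ k)) hD ?_ _ ?_ ?_
        · -- `2 * D / 2 ^ (2 * k + 1) = D / 4 ^ k`, and `1 / 2 ^ k ≤ η`.
          have h2 : 1 / 2 ^ k ≤ η := one_div_le_one_div_of_le (by positivity) hak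
          calc 2 * (D / 2 ^ (2 * k + 1)) = 1 / 2 ^ k * (D / 2 ^ k) := by
                rw [pow_succ, two_mul k, pow_add]; field_simp
            _ ≤ _ := by gcongr
        · intro y hy
          obtain ⟨j', hj', rfl⟩ := Finset.mem_image.1 hy
          exact hdist j' hj'
        · intro y hy z hz hyz
          obtain ⟨j', hj', rfl⟩ := Finset.mem_image.1 hy
          obtain ⟨j'', hj'', rfl⟩ := Finset.mem_image.1 hz
          exact hY.separated _ j'.1.2 _ j''.1.2 hyz
      have h2 : t.card ≤ ((t.image fun j' => (j'.1 : X)) ×ˢ (Finset.univ : Finset (Fin k))).card := by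
        refine Finset.card_le_card_of_injOn (fun j' => ((j'.1 : X), j'.2)) (fun j' hj' => ?_) ?_
        · exact Finset.mem_coe.2 (Finset.mem_product.2
            ⟨Finset.mem_image_of_mem _ hj', Finset.mem_univ _⟩)
        · intro j' _ j'' _ h
          exact Prod.ext (Subtype.ext (Prod.ext_iff.1 h).1) (Prod.ext_iff.1 h).2
      rw [Finset.card_product, Finset.card_univ, Fintype.card_fin] at h2
      have h3 : t.card ≤ k * n ^ (2 * k + 1) := by
        rw [mul_comm]; exact h2.trans (Nat.mul_le_mul_right _ h1)
      exact_mod_cast h3)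
    (by nlinarith [one_le_pow₀ hn' (n := 2 * k + 1)]) hM
  let Q : Fin M → ℕ → Setoid X := fun m ℓ =>
    if h : ℓ < k then carve (N ℓ) (R ℓ) fun v => ω (m, ⟨ℓ, h⟩, v) else ⊥
  have hQ : ∀ m ℓ (h : ℓ < k), Q m ℓ = carve (N ℓ) (R ℓ) fun v => ω (m, ⟨ℓ, h⟩, v) :=
    fun m ℓ h => dif_pos h
  have hQ' : ∀ m ℓ, ¬ ℓ < k → Q m ℓ = ⊥ := fun m ℓ h => dif_neg h
  refine ⟨Q, ?_, ?_⟩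
  · intro m ℓ x y hxy
    by_cases h : ℓ < k
    · rw [hQ m ℓ h] at hxy
      refine (dist_le_of_carve (hR0 ℓ).le _ hxy).trans_eq ?_
      simp only [hR]; ring
    · rw [hQ' m ℓ h] at hxy
      have : x = y := hxy
      rw [this, dist_self]
      positivity
  · intro x s hs
    obtain ⟨y, hy, hxy⟩ := hY.covers x
    have := hω (⟨y, hy⟩, ⟨s, hs⟩)
    simp only [A, Set.mem_iInter, Set.mem_compl_iff, not_forall, not_not] at this
    obtain ⟨m, hm⟩ := this
    refine ⟨m, fun ℓ hℓ => ?_⟩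
    have hmem : ω ∈ P m ⟨s, hs⟩ ⟨ℓ, hℓ.trans_lt hs⟩ y :=
      Set.mem_iInter₂.1 hm ⟨ℓ, hℓ.trans_lt hs⟩ (Finset.mem_filter.2 ⟨Finset.mem_univ _, hℓ⟩)
    have hpad := closedBall_subset_of_mem_padEvent (hR0 ℓ) (hρ0 s).le hmem
    have hks : η * (D / 2 ^ k) ≤ η * (D / 2 ^ s) := by
      gcongr
      exact one_le_two
    have hsub : ∀ z, dist z x ≤ 2 * η * (D / 2 ^ s) → z ∈ Metric.closedBall y (ρ s) := by
      intro z hz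
      rw [Metric.mem_closedBall]
      simp only [hρ]
      linarith [dist_triangle z x y]
    rw [hQ m ℓ (hℓ.trans_lt hs)]
    intro z hz
    have hz' := hpad (hsub z hz)
    have hx' := hpad (hsub x (by rw [dist_self]; positivity))
    exact mem_cluster.2
      (Setoid.trans' _ (mem_cluster.1 hz') (Setoid.symm' _ (mem_cluster.1 hx')))

/-! ### Gluing partitions into hierarchies -/

section Gluing

variable {X : Type*}

/-- A choice of a representative in each cluster of a partition. -/
noncomputable def rep (S : Setoid X) (x : X) : X := (Quotient.mk S x).out

theorem rel_rep (S : Setoid X) (x : X) : S (rep S x) x := Quotient.mk_out (s := S) x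

theorem rep_eq_rep {S : Setoid X} {x y : X} (h : S x y) : rep S x = rep S y :=
  congrArg Quotient.out (Quotient.sound (s := S) h)

/-- The coarsening of `S` that puts each cluster of `S` as a whole into the cluster of `Q` that
contains its representative. -/
noncomputable def merge (S Q : Setoid X) : Setoid X := Q.comap (rep S)

theorem merge_rel {S Q : Setoid X} {x y : X} : merge S Q x y ↔ Q (rep S x) (rep S y) := Iff.rfl

theorem le_merge (S Q : Setoid X) : S ≤ merge S Q := fun x y h => by
  rw [merge_rel, rep_eq_rep h]

theorem merge_mono (S : Setoid X) {Q Q' : Setoid X} (h : Q ≤ Q') : merge S Q ≤ merge S Q' :=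
  fun _ _ hxy => h hxy

theorem dist_le_of_merge [MetricSpace X] {S Q : Setoid X} {δ Δ : ℝ}
    (hS : ∀ x y, S x y → dist x y ≤ δ) (hQ : ∀ x y, Q x y → dist x y ≤ Δ) {x y : X}
    (h : merge S Q x y) : dist x y ≤ Δ + 2 * δ := by
  have h1 := hS _ _ (rel_rep S x)
  have h2 := hS _ _ (rel_rep S y)
  have h3 := hQ _ _ (merge_rel.1 h)
  have h4 := dist_triangle4 x (rep S x) (rep S y) y
  rw [dist_comm] at h1
  linarith

/-- Merging costs at most the diameter of the merged clusters in the padding radius. -/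
theorem closedBall_subset_merge [MetricSpace X] {S Q : Setoid X} {δ r : ℝ} (hr : 0 ≤ r)
    (hS : ∀ x y, S x y → dist x y ≤ δ) {x : X}
    (h : Metric.closedBall x (r + δ) ⊆ cluster Q x) :
    Metric.closedBall x r ⊆ cluster (merge S Q) x := by
  have key : ∀ z, dist z x ≤ r → Q (rep S z) x := fun z hz => by
    refine mem_cluster.1 (h ?_)
    rw [Metric.mem_closedBall]
    linarith [dist_triangle (rep S z) z x, hS _ _ (rel_rep S z)]
  intro z hz
  exact mem_cluster.2 (merge_rel.2
    (Setoid.trans' _ (key z hz) (Setoid.symm' _ (key x (by simpa using hr)))))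

/-- The top partitions of the blocks, from the finest scales up: `blockTop k Q nb n` is the top
partition of block `nb - n`, obtained by merging the clusters of the next block. -/
noncomputable def blockTop (k : ℕ) (Q : ℕ → Setoid X) (nb : ℕ) : ℕ → Setoid X
  | 0 => ⊥
  | n + 1 => merge (blockTop k Q nb n) (Q (2 * k * (nb - (n + 1))))

/-- Partitions at all scales, of which the upper half of each block of `2 * k` scales is under
control, are glued to a hierarchy. In the upper half of a block the given partitions are
intersected with those above them in the block, and then the clusters of the next block are
merged; in the lower half the top partition of the next block is repeated. -/
theorem exists_hierarchy [MetricSpace X] {k : ℕ} (hk : 1 ≤ k) {Δ : ℝ} (hΔ : 0 < Δ)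
    (Q : ℕ → Setoid X) (hQ : ∀ i x y, Q i x y → dist x y ≤ Δ / 2 ^ i / 2) (B : ℕ) :
    ∃ P : ℕ → Setoid X, (∀ i, P (i + 1) ≤ P i) ∧
      (∀ i x y, P i x y → dist x y ≤ Δ / 2 ^ i) ∧
      ∀ b s x r, s < k → 2 * k * b + s ≤ B → 0 ≤ r →
        (∀ ℓ ≤ s, Metric.closedBall x (r + Δ / 2 ^ (2 * k * (b + 1))) ⊆
          cluster (Q (2 * k * b + ℓ)) x) →
        Metric.closedBall x r ⊆ cluster (P (2 * k * b + s)) x := by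
  have hk0 : 0 < 2 * k := by omega
  set nb := B + 1 with hnb
  set S : ℕ → Setoid X := fun b => blockTop k Q nb (nb - b) with hSdef
  have hS1 : ∀ b, b < nb → S b = merge (S (b + 1)) (Q (2 * k * b)) := fun b hb => by
    obtain ⟨n, hn⟩ : ∃ n, nb - b = n + 1 := ⟨nb - b - 1, by omega⟩
    have h1 : nb - (b + 1) = n := by omega
    have h2 : nb - (n + 1) = b := by omega
    simp only [hSdef, hn, h1, blockTop, h2]
  have hS2 : ∀ b, nb ≤ b → S b = ⊥ := fun b hb => by
    simp [hSdef, Nat.sub_eq_zero_of_le hb, blockTop]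
  -- Two scales further down, the diameters have shrunk by a factor of four.
  have hscale : ∀ i j, i + 2 ≤ j → Δ / 2 ^ i / 2 + 2 * (Δ / 2 ^ j) ≤ Δ / 2 ^ i := fun i j hij => by
    have h1 : Δ / 2 ^ j ≤ Δ / 2 ^ (i + 2) := by
      gcongr
      exact one_le_two
    have h2 : Δ / 2 ^ (i + 2) = Δ / 2 ^ i / 4 := by rw [pow_add]; field_simp; norm_num
    linarith
  have hbot : ∀ i x y, (⊥ : Setoid X) x y → dist x y ≤ Δ / 2 ^ i := fun i x y h => by
    have : x = y := h
    rw [this, dist_self]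
    positivity
  have hSb : ∀ n b, nb - b = n → ∀ x y, S b x y → dist x y ≤ Δ / 2 ^ (2 * k * b) := by
    intro n
    induction n with
    | zero =>
      intro b hb x y h
      rw [hS2 b (by omega)] at h
      exact hbot _ x y h
    | succ n ih =>
      intro b hb x y h
      rw [hS1 b (by omega)] at h
      refine (dist_le_of_merge (ih (b + 1) (by omega)) (hQ _) h).trans (hscale _ _ ?_)
      rw [mul_add]; omega
  have hSb' : ∀ b x y, S b x y → dist x y ≤ Δ / 2 ^ (2 * k * b) := fun b => hSb _ b rfl
  set F : ℕ → ℕ → Setoid X := fun b s =>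
    if nb ≤ b then ⊥ else if s < k then merge (S (b + 1)) (⨅ ℓ ∈ Finset.range (s + 1),
      Q (2 * k * b + ℓ)) else S (b + 1) with hF
  have hF0 : ∀ b s, nb ≤ b → F b s = ⊥ := fun b s h => if_pos h
  have hF1 : ∀ b s, ¬ nb ≤ b → s < k → F b s = merge (S (b + 1))
      (⨅ ℓ ∈ Finset.range (s + 1), Q (2 * k * b + ℓ)) := fun b s h h' => by
    simp only [hF, if_neg h, if_pos h']
  have hF2 : ∀ b s, ¬ nb ≤ b → k ≤ s → F b s = S (b + 1) := fun b s h h' => by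
    simp only [hF, if_neg h, if_neg h'.not_gt]
  have hdm : ∀ b s, s < 2 * k → (2 * k * b + s) / (2 * k) = b ∧ (2 * k * b + s) % (2 * k) = s :=
    fun b s h => ⟨by rw [Nat.mul_add_div hk0, Nat.div_eq_of_lt h, add_zero],
      by rw [Nat.mul_add_mod, Nat.mod_eq_of_lt h]⟩
  set P : ℕ → Setoid X := fun i => F (i / (2 * k)) (i % (2 * k)) with hP
  have hPF : ∀ b s, s < 2 * k → P (2 * k * b + s) = F b s := fun b s h => by
    simp only [hP, (hdm b s h).1, (hdm b s h).2]
  have hrepr : ∀ i, ∃ b s, s < 2 * k ∧ i = 2 * k * b + s := fun i =>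
    ⟨i / (2 * k), i % (2 * k), Nat.mod_lt _ hk0, (Nat.div_add_mod i (2 * k)).symm⟩
  refine ⟨P, fun i => ?_, fun i => ?_, ?_⟩
  · obtain ⟨b, s, hs, rfl⟩ := hrepr i
    rw [hPF b s hs]
    rcases Nat.lt_or_ge (s + 1) (2 * k) with h | h
    · rw [add_assoc, hPF b (s + 1) h]
      by_cases hb : nb ≤ b
      · rw [hF0 b _ hb]; exact bot_le
      rcases Nat.lt_or_ge (s + 1) k with h' | h'
      · rw [hF1 b _ hb h', hF1 b s hb (by omega)]
        exact merge_mono _ (biInf_mono fun ℓ hℓ => Finset.range_mono (by omega) hℓ)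
      · rw [hF2 b _ hb h']
        rcases Nat.lt_or_ge s k with h'' | h''
        · rw [hF1 b s hb h'']; exact le_merge _ _
        · rw [hF2 b s hb h'']
    · have h1 : 2 * k * b + s + 1 = 2 * k * (b + 1) + 0 := by rw [mul_add]; omega
      rw [h1, hPF (b + 1) 0 hk0]
      by_cases hb : nb ≤ b + 1
      · rw [hF0 _ _ hb]; exact bot_le
      · rw [hF1 _ _ hb (by omega), hF2 b s (by omega) (by omega), hS1 (b + 1) (by omega)]
        simp
  · obtain ⟨b, s, hs, rfl⟩ := hrepr i
    rw [hPF b s hs]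
    intro x y h
    by_cases hb : nb ≤ b
    · rw [hF0 b _ hb] at h; exact hbot _ x y h
    rcases Nat.lt_or_ge s k with h' | h'
    · rw [hF1 b s hb h'] at h
      have hle : (⨅ ℓ ∈ Finset.range (s + 1), Q (2 * k * b + ℓ)) ≤ Q (2 * k * b + s) :=
        biInf_le _ (Finset.self_mem_range_succ s)
      refine (dist_le_of_merge (hSb' (b + 1)) (fun x y hxy => hQ _ x y (hle hxy)) h).trans
        (hscale _ _ ?_)
      rw [mul_add]; omega
    · rw [hF2 b s hb h'] at h
      refine (hSb' (b + 1) x y h).trans ?_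
      gcongr
      · exact one_le_two
      · rw [mul_add]; omega
  · intro b s x r hs hB hr hpad
    have hb : ¬ nb ≤ b := by
      have : b ≤ 2 * k * b := Nat.le_mul_of_pos_left b hk0
      omega
    rw [hPF b s (by omega), hF1 b s hb hs]
    refine closedBall_subset_merge hr (hSb' (b + 1)) fun z hz => mem_cluster.2 ?_
    refine Setoid.sInf_iff.2 ?_
    rintro _ ⟨ℓ, rfl⟩
    refine Setoid.sInf_iff.2 ?_
    rintro _ ⟨hℓ, rfl⟩
    exact mem_cluster.1 (hpad ℓ (Nat.lt_succ_iff.1 (Finset.mem_range.1 hℓ)) hz)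

end Gluing

/-! ### The padded family -/

/-- For each offset `o`, there are `M` hierarchies which together pad every point at the scales
`i` for which `i + o` lies in the upper half of a block of `2 * k` scales. -/
theorem exists_hierarchies_of_offset {X : Type*} [MetricSpace X] [Finite X] [Nontrivial X]
    {n k M : ℕ} (hn : 1 ≤ n) (hX : HasDoublingBound X n) {a β : ℝ} (ha : 24 ≤ a) (hk : 1 ≤ k)
    (hak : 48 * a ≤ 2 ^ k) (hβ : β = 2 * Real.log (2 * k * n ^ 3))
    (hM : 4 * (1 - 1 / 2 * Real.exp (-(2 * β / a))) ^ M * (k * n ^ (2 * k + 1)) ≤ 1) (o : ℕ) :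
    ∃ H : Fin M → FullHierarchicalPartition X 2, ∀ (x : X) (i : Fin (numLevels X 2 + 1)),
      ((i : ℕ) + o) % (2 * k) < k → ∃ m,
        Metric.closedBall x (1 / (48 * a) * (dMax X / 2 ^ (i : ℕ))) ⊆
          cluster ((H m).part i) x := by
  have hk0 : 0 < 2 * k := by omega
  have hdmax : 0 < dMax X := by
    obtain ⟨x, y, hxy⟩ := exists_pair_ne X
    exact (dist_pos.2 hxy).trans_le
      (Metric.dist_le_diam_of_mem Set.finite_univ.isBounded (Set.mem_univ x) (Set.mem_univ y))
  -- The scale of index `0` is chosen so that the scale of index `o` is `dMax X`.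
  set Δ : ℝ := dMax X * 2 ^ o with hΔ
  have hΔ0 : 0 < Δ := by positivity
  have hshift : ∀ i, Δ / 2 ^ (i + o) = dMax X / 2 ^ i := fun i => by
    rw [hΔ, pow_add]; field_simp
  choose Q hQd hQp using fun b : ℕ => exists_block_partitions (M := M) hn hX
    (D := Δ / 2 ^ (2 * k * b)) (by positivity) ha hk hak hβ hM
  choose P hPle hPd hPp using fun m : Fin M => exists_hierarchy hk hΔ0
    (fun i => Q (i / (2 * k)) m (i % (2 * k))) (fun i x y h => by
      refine (hQd _ m _ x y h).trans_eq ?_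
      rw [div_div Δ, ← pow_add, Nat.div_add_mod]) (numLevels X 2 + o)
  refine ⟨fun m => ⟨fun i => P m (i + o), fun i C hC => ?_, fun i => ?_⟩, fun x i hi => ?_⟩
  · obtain ⟨x, rfl⟩ := hC
    refine Metric.diam_le_of_forall_dist_le (by positivity) fun y hy z hz => ?_
    rw [← hshift]
    exact hPd m _ y z (Setoid.trans' _ hy (Setoid.symm' _ hz))
  · have := hPle m (i + o)
    rw [add_right_comm] at this
    exact this
  · set b := ((i : ℕ) + o) / (2 * k) with hb
    set s := ((i : ℕ) + o) % (2 * k) with hs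
    have hbs : 2 * k * b + s = i + o := Nat.div_add_mod _ _
    obtain ⟨m, hm⟩ := hQp b x s hi
    refine ⟨m, ?_⟩
    have hr : 0 ≤ 1 / (48 * a) * (dMax X / 2 ^ (i : ℕ)) := by
      have : 0 < a := by linarith
      positivity
    have := hPp m b s x _ hi (by rw [hbs]; have := i.2; omega) hr fun ℓ hℓ => ?_
    · rw [hbs] at this
      exact this
    · have hℓ2 : ℓ < 2 * k := by omega
      rw [Nat.mul_add_div hk0, Nat.div_eq_of_lt hℓ2, add_zero, Nat.mul_add_mod,
        Nat.mod_eq_of_lt hℓ2]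
      refine (Metric.closedBall_subset_closedBall ?_).trans (hm ℓ hℓ)
      -- The next block starts at least `k` scales further down, where the scale is `≤ η * Δ_i`.
      have h1 : Δ / 2 ^ (2 * k * (b + 1)) ≤ 1 / (48 * a) * (dMax X / 2 ^ (i : ℕ)) := by
        have h2 : (1 : ℝ) / 2 ^ k ≤ 1 / (48 * a) :=
          one_div_le_one_div_of_le (by linarith) hak
        calc Δ / 2 ^ (2 * k * (b + 1)) ≤ Δ / 2 ^ (k + (i + o)) := by
              gcongr
              · exact one_le_two
              · rw [mul_add]; omega
          _ = 1 / 2 ^ k * (dMax X / 2 ^ (i : ℕ)) := by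
              rw [← hshift, pow_add]; field_simp
          _ ≤ _ := by gcongr
      have h3 : Δ / 2 ^ (2 * k * b) / 2 ^ s = dMax X / 2 ^ (i : ℕ) := by
        rw [div_div, ← pow_add, hbs, hshift]
      rw [h3]
      linarith

/-- The block length: `2 ^ k` exceeds `576 * α`, while `k` is of order `log α`. -/
theorem exists_block_length {α : ℝ} (hα : 2 ≤ α) :
    ∃ k : ℕ, 1 ≤ k ∧ 576 * α ≤ 2 ^ k ∧ (k : ℝ) ≤ 24 * Real.log α := by
  have hceil : 1 < ⌈576 * α⌉₊ := Nat.lt_ceil.2 (by push_cast; linarith)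
  refine ⟨Nat.clog 2 ⌈576 * α⌉₊, Nat.clog_pos one_lt_two hceil, ?_, ?_⟩
  · exact (Nat.le_ceil _).trans (by exact_mod_cast Nat.le_pow_clog one_lt_two _)
  · set k := Nat.clog 2 ⌈576 * α⌉₊ with hk
    have hk1 : 1 ≤ k := Nat.clog_pos one_lt_two hceil
    have h1 : ((2 ^ (k - 1) : ℕ) : ℝ) < 576 * α :=
      Nat.lt_ceil.1 (Nat.pow_pred_clog_lt_self one_lt_two hceil)
    have h2 : Real.log ((2 ^ (k - 1) : ℕ) : ℝ) ≤ Real.log (2 ^ 10 * α) :=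
      Real.log_le_log (by positivity) (by linarith)
    rw [Real.log_mul (by norm_num) (by linarith), Real.log_pow] at h2
    push_cast at h2
    rw [Real.log_pow, Nat.cast_sub hk1] at h2
    push_cast at h2
    have h3 : Real.log 2 ≤ Real.log α := Real.log_le_log two_pos hα
    have h4 := Real.log_two_gt_d9
    have h5 : (1 : ℝ) ≤ k := by exact_mod_cast hk1
    nlinarith

/-- The number of hierarchies. The local lemma has to deal with `k * n ^ (2 * k + 1)`
neighbouring events, and each hierarchy pads with probability at least
`1 / 2 * exp (-16) * n ^ (-1 / α)`. -/
theorem exists_family_size {n k : ℕ} {α : ℝ} (hn : 2 ≤ n) (hα : 2 ≤ α) (hk : 1 ≤ k)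
    (hkα : (k : ℝ) ≤ 24 * Real.log α) :
    ∃ M : ℕ, (M : ℝ) ≤ (528 * Real.exp 16 + 4) *
        ((n : ℝ) ^ (1 / α) * Real.log α * Real.log n) ∧
      4 * (1 - 1 / 2 * Real.exp (-(2 * (2 * Real.log (2 * k * n ^ 3)) / (12 * α)))) ^ M *
        (k * n ^ (2 * k + 1)) ≤ 1 := by
  have hn' : (2 : ℝ) ≤ n := by exact_mod_cast hn
  have hk' : (1 : ℝ) ≤ k := by exact_mod_cast hk
  have hlog2 := Real.log_two_gt_d9
  have hlogα : 1 / 2 ≤ Real.log α := by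
    have := Real.log_le_log two_pos hα; linarith
  have hlogn : 1 / 2 ≤ Real.log n := by
    have := Real.log_le_log two_pos hn'; linarith
  set q := 1 / 2 * Real.exp (-(2 * (2 * Real.log (2 * k * n ^ 3)) / (12 * α))) with hq
  have hnα : 1 ≤ (n : ℝ) ^ (1 / α) := Real.one_le_rpow (by linarith) (by positivity)
  have hq0 : 0 < q := by positivity
  have hlogk : Real.log (2 * k) ≤ 48 * α := by
    have h1 := Real.log_le_sub_one_of_pos (show (0 : ℝ) < 2 * k by linarith)
    have h2 := Real.log_le_sub_one_of_pos (show (0 : ℝ) < α by linarith)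
    linarith
  have hq1 : 1 / q ≤ 2 * Real.exp 16 * (n : ℝ) ^ (1 / α) := by
    have h1 : 2 * (2 * Real.log (2 * k * n ^ 3)) / (12 * α) ≤ 16 + Real.log n * (1 / α) := by
      rw [Real.log_mul (by positivity) (by positivity), Real.log_pow, div_le_iff₀ (by linarith)]
      have h2 : (16 + Real.log n * (1 / α)) * (12 * α) = 192 * α + 12 * Real.log n := by
        field_simp; ring
      rw [h2]
      push_cast
      linarith
    rw [hq, one_div, mul_inv, ← Real.exp_neg, neg_neg, Real.rpow_def_of_pos (by linarith),
      mul_assoc 2 (Real.exp 16), ← Real.exp_add, one_div, inv_inv]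
    gcongr
  have hq_le : q ≤ 1 := by
    have h1 : 0 ≤ Real.log (2 * k * n ^ 3) :=
      Real.log_nonneg (by nlinarith [one_le_pow₀ (by linarith : (1 : ℝ) ≤ n) (n := 3)])
    have : Real.exp (-(2 * (2 * Real.log (2 * k * n ^ 3)) / (12 * α))) ≤ 1 := by
      rw [Real.exp_le_one_iff, neg_nonpos]; positivity
    linarith
  set L := 11 * k * Real.log n with hL
  have hL0 : 0 < L := by positivity
  refine ⟨⌈L / q⌉₊, ?_, ?_⟩
  · have h1 := (Nat.ceil_lt_add_one (show 0 ≤ L / q by positivity)).le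
    have h2 : L / q ≤ 11 * (24 * Real.log α) * Real.log n *
        (2 * Real.exp 16 * (n : ℝ) ^ (1 / α)) := by
      rw [div_eq_mul_one_div, hL]
      gcongr
    have h3 : 1 ≤ 4 * ((n : ℝ) ^ (1 / α) * Real.log α * Real.log n) := by
      have : 1 / 4 ≤ Real.log α * Real.log n := by nlinarith
      nlinarith
    linarith
  · have h1 : (1 - q) ^ ⌈L / q⌉₊ ≤ Real.exp (-L) := by
      calc (1 - q) ^ ⌈L / q⌉₊ ≤ Real.exp (-q) ^ ⌈L / q⌉₊ := by
            gcongr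
            exact Real.one_sub_le_exp_neg q
        _ = Real.exp (-(q * ⌈L / q⌉₊)) := by rw [← Real.exp_nat_mul]; ring_nf
        _ ≤ _ := by
            rw [Real.exp_le_exp, neg_le_neg_iff]
            have := Nat.le_ceil (L / q)
            rwa [div_le_iff₀ hq0, mul_comm] at this
    have h2 : 4 * (k * (n : ℝ) ^ (2 * k + 1)) ≤ Real.exp L := by
      rw [← Real.log_le_iff_le_exp (by positivity), ← mul_assoc,
        Real.log_mul (by positivity) (by positivity), Real.log_pow]
      have h3 := Real.log_le_sub_one_of_pos (show (0 : ℝ) < 4 * k by linarith)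
      push_cast
      nlinarith
    calc _ = (1 - q) ^ ⌈L / q⌉₊ * (4 * (k * (n : ℝ) ^ (2 * k + 1))) := by ring
      _ ≤ Real.exp (-L) * Real.exp L := by gcongr
      _ = 1 := by rw [← Real.exp_add]; simp

theorem mainTheorem3 :
    ∃ c C : ℝ, 0 < c ∧ 0 < C ∧
      ∀ (X : Type u) [MetricSpace X] [Finite X] [Nontrivial X] (α : ℝ), 2 ≤ α →
        ∃ η : ℝ, c / α ≤ η ∧ η < 1 ∧
          ∃ 𝓗 : Finset (FullHierarchicalPartition X 2),
            IsPaddedFamily η 𝓗 ∧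
            (𝓗.card : ℝ) ≤
              C * ((doublingConstant X : ℝ) ^ (1 / α) * Real.log α *
                Real.log (doublingConstant X : ℝ)) := by
  classical
  refine ⟨1 / 576, 2 * (528 * Real.exp 16 + 4), by norm_num, by positivity, ?_⟩
  intro X _ _ _ α hα
  have hn := two_le_doublingConstant X
  have hX := hasDoublingBound_doublingConstant X
  set n := doublingConstant X
  obtain ⟨k, hk, hαk, hkα⟩ := exists_block_length hα
  obtain ⟨M, hMle, hM⟩ := exists_family_size hn hα hk hkα
  have hak : 48 * (12 * α) ≤ 2 ^ k := by linarith
  -- Two offsets suffice: each scale is in the upper half of a block for one of them.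
  obtain ⟨H₀, hH₀⟩ := exists_hierarchies_of_offset (by omega) hX (by linarith) hk hak rfl hM 0
  obtain ⟨H₁, hH₁⟩ := exists_hierarchies_of_offset (by omega) hX (by linarith) hk hak rfl hM k
  refine ⟨1 / (48 * (12 * α)), ?_, ?_, Finset.univ.image H₀ ∪ Finset.univ.image H₁, ?_, ?_⟩
  · rw [div_div]
    exact le_of_eq (by ring)
  · rw [div_lt_one (by linarith)]
    linarith
  · intro x i
    by_cases hi : (i : ℕ) % (2 * k) < k
    · obtain ⟨m, hm⟩ := hH₀ x i (by simpa using hi)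
      exact ⟨H₀ m, Finset.mem_union_left _ (Finset.mem_image_of_mem _ (Finset.mem_univ m)), hm⟩
    · have hi' : ((i : ℕ) + k) % (2 * k) < k := by
        have h1 := Nat.mod_lt (i : ℕ) (show 2 * k > 0 by omega)
        rw [Nat.add_mod, Nat.mod_eq_of_lt (show k < 2 * k by omega),
          Nat.mod_eq_sub_mod (by omega), Nat.mod_eq_of_lt (by omega)]
        omega
      obtain ⟨m, hm⟩ := hH₁ x i hi'
      exact ⟨H₁ m, Finset.mem_union_right _ (Finset.mem_image_of_mem _ (Finset.mem_univ m)), hm⟩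
  · have h1 : (Finset.univ.image H₀ ∪ Finset.univ.image H₁).card ≤ 2 * M := by
      refine (Finset.card_union_le _ _).trans ?_
      have h2 := Finset.card_image_le (s := Finset.univ) (f := H₀)
      have h3 := Finset.card_image_le (s := Finset.univ) (f := H₁)
      simp only [Finset.card_univ, Fintype.card_fin] at h2 h3
      omega
    have h2 : ((Finset.univ.image H₀ ∪ Finset.univ.image H₁).card : ℝ) ≤ 2 * M := by
      exact_mod_cast h1
    linarith
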